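/- Let $G=(V,E)$ be a finite, simple, connected graph, equipped with the unit weight (all vertex measures and all edge weights equal to $1$), and let $B\subset V$ be a vertex-boundary with $|B|\ge 2$: no two vertices of $B$ are adjacent, and every vertex of $B$ is adjacent to some vertex of $\Omega:=V\setminus B$. For $u\in\mathbb R^V$ let $\Delta u(x)=\sum_{y\sim x}(u(y)-u(x))$. For $f\in\mathbb R^B$ let $u_f\in\mathbb R^V$ be its harmonic extension, i.e. the unique function with $u_f=f$ on $B$ and $\Delta u_f=0$ on $\Omega$. The Dirichlet-to-Neumann map $\Lambda:\mathbb R^B\to\mathbb R^B$, $$\Lambda f(x)=\frac{\partial u_f}{\partial n}(x)=\sum_{y\sim x}(u_f(x)-u_f(y))=-\Delta u_f(x)\qquad(x\in B),$$ is self-adjoint for the standard inner product; let $\sigma_1\le\sigma_2\le\cdots\le\sigma_{|B|}$ be its eigenvalues (Steklov eigenvalues), counted with multiplicity. Let $e(G)$ be the edge connectivity and $v(G)$ the vertex connectivity of $G$, i.e. the least number of edges, respectively vertices, whose deletion makes $G$ disconnected. Then $$\sigma_2\ \ge\ 2e(G)\left(1-\cos\frac{\pi}{|V|}\right)\ \ge\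 2v(G)\left(1-\cos\frac{\pi}{|V|}\right).$$ -/

import Mathlib

namespace Steklov

variable {V : Type*}

/-! ### Graphs with boundary and connectivity numbers -/

/-- `(G, B)` is a graph with boundary: no two vertices of `B` are adjacent, and every vertex
of `B` is adjacent to some vertex of the interior `V \ B`. -/
structure IsBoundary (G : SimpleGraph V) (B : Finset V) : Prop where
  not_adj : ∀ x ∈ B, ∀ y ∈ B, ¬ G.Adj x y
  exists_adj : ∀ x ∈ B, ∃ y, y ∉ B ∧ G.Adj x y

/-- Edge connectivity: the least number of edges whose deletion disconnects the graph. -/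
noncomputable def edgeConnectivity (G : SimpleGraph V) : ℕ :=
  sInf {k | ∃ S : Finset (Sym2 V), (S : Set (Sym2 V)) ⊆ G.edgeSet ∧
    ¬ (G.deleteEdges (S : Set (Sym2 V))).Preconnected ∧ S.card = k}

/-- Vertex connectivity: the least number of vertices whose deletion disconnects the graph.
(Such a set of vertices exists as soon as the graph has two distinct non-adjacent vertices.) -/
noncomputable def vertexConnectivity (G : SimpleGraph V) : ℕ :=
  sInf {k | ∃ S : Finset V, ¬ (G.induce {x | x ∉ S}).Preconnected ∧ S.card = k}

/-! ### The Laplacian, harmonic extension and the Dirichlet-to-Neumann map (unit weight) -/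

variable [Fintype V] [DecidableEq V]

/-- The Laplacian `Δ u (x) = ∑_{y ∼ x} (u y - u x)` of the unit weight; it is the negative of
Mathlib's `lapMatrix`, see `laplacian_apply`. -/
noncomputable def laplacian (G : SimpleGraph V) [DecidableRel G.Adj] :
    (V → ℝ) →ₗ[ℝ] (V → ℝ) :=
  -(Matrix.toLin' (G.lapMatrix ℝ))

theorem laplacian_apply (G : SimpleGraph V) [DecidableRel G.Adj] (u : V → ℝ) (x : V) :
    laplacian G u x = ∑ y ∈ G.neighborFinset x, (u y - u x) := by
  simp [laplacian, SimpleGraph.lapMatrix_mulVec_apply]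

theorem sum_laplacian_mul_comm (G : SimpleGraph V) [DecidableRel G.Adj] (u v : V → ℝ) :
    ∑ x, laplacian G u x * v x = ∑ x, u x * laplacian G v x := by
  have h : (G.lapMatrix ℝ).mulVec u ⬝ᵥ v = u ⬝ᵥ (G.lapMatrix ℝ).mulVec v := by
    rw [Matrix.dotProduct_mulVec, ← Matrix.mulVec_transpose, (G.isSymm_lapMatrix ℝ).eq]
  simpa [laplacian, dotProduct] using h

/-- The operator `u ↦ (Δ u on the interior, u on the boundary)` of the Dirichlet problem. -/
noncomputable def dirichletOperator (G : SimpleGraph V) [DecidableRel G.Adj] (B : Finset V) :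
    (V → ℝ) →ₗ[ℝ] (V → ℝ) where
  toFun u x := if x ∈ B then u x else laplacian G u x
  map_add' u v := by ext x; by_cases h : x ∈ B <;> simp [h]
  map_smul' c u := by ext x; by_cases h : x ∈ B <;> simp [h]

/-- Unique solvability of the Dirichlet problem on a connected graph with non-empty boundary. -/
theorem dirichletOperator_injective (G : SimpleGraph V) [DecidableRel G.Adj] (B : Finset V)
    (hG : G.Connected) (hB : B.Nonempty) : Function.Injective (dirichletOperator G B) := by
  rw [← LinearMap.ker_eq_bot, LinearMap.ker_eq_bot']
  intro u hu
  have hx : ∀ x, (if x ∈ B then u x else laplacian G u x) = 0 := fun x => congrFun hu x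
  have h0 : Matrix.toLinearMap₂' ℝ (G.lapMatrix ℝ) u u = 0 := by
    rw [Matrix.toLinearMap₂'_apply', dotProduct]
    refine Finset.sum_eq_zero fun x _ => ?_
    have := hx x
    by_cases h : x ∈ B
    · simp only [h, if_true] at this
      simp [this]
    · simp only [h, if_false, laplacian, LinearMap.neg_apply, Pi.neg_apply,
        Matrix.toLin'_apply, neg_eq_zero] at this
      simp [this]
  rw [SimpleGraph.lapMatrix_toLinearMap₂'_apply'_eq_zero_iff_forall_reachable] at h0
  obtain ⟨b, hb⟩ := hB
  ext x
  rw [h0 x b (hG.preconnected x b)]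
  simpa [hb] using hx b

/-- The harmonic extension `u_f` of `f ∈ ℝ^B`: the unique function on `V` that equals `f` on `B`
and satisfies `Δ u_f = 0` off `B`, see `eq_harmonicExtension_iff`. -/
noncomputable def harmonicExtension (G : SimpleGraph V) [DecidableRel G.Adj] (B : Finset V)
    (hG : G.Connected) (hB : B.Nonempty) : (B → ℝ) →ₗ[ℝ] (V → ℝ) :=
  (LinearEquiv.ofInjectiveEndo (dirichletOperator G B)
      (dirichletOperator_injective G B hG hB)).symm.toLinearMap ∘ₗ
    { toFun := fun f x => if h : x ∈ B then f ⟨x, h⟩ else 0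
      map_add' := fun f g => by ext x; by_cases h : x ∈ B <;> simp [h]
      map_smul' := fun c f => by ext x; by_cases h : x ∈ B <;> simp [h] }

theorem eq_harmonicExtension_iff (G : SimpleGraph V) [DecidableRel G.Adj] (B : Finset V)
    (hG : G.Connected) (hB : B.Nonempty) (f : B → ℝ) (u : V → ℝ) :
    u = harmonicExtension G B hG hB f ↔
      (∀ x, x ∉ B → laplacian G u x = 0) ∧ ∀ x : B, u x = f x := by
  rw [harmonicExtension, LinearMap.comp_apply, LinearEquiv.coe_coe, LinearEquiv.eq_symm_apply,
    LinearEquiv.coe_ofInjectiveEndo, funext_iff]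
  simp only [dirichletOperator, LinearMap.coe_mk, AddHom.coe_mk]
  constructor
  · refine fun h => ⟨fun x hx => by simpa [hx] using h x, fun x => by simpa using h x⟩
  · rintro ⟨h1, h2⟩ x
    by_cases hx : x ∈ B
    · simpa [hx] using h2 ⟨x, hx⟩
    · simpa [hx] using h1 x hx

/-- The Dirichlet-to-Neumann map `Λ f = ∂u_f/∂n`, where `∂u/∂n (x) = ∑_{y ∼ x} (u x - u y)`
`= -Δ u (x)` for `x ∈ B`. -/
noncomputable def dirichletToNeumann (G : SimpleGraph V) [DecidableRel G.Adj] (B : Finset V)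
    (hG : G.Connected) (hB : B.Nonempty) : EuclideanSpace ℝ B →ₗ[ℝ] EuclideanSpace ℝ B where
  toFun f := WithLp.toLp 2 fun x : B => -laplacian G (harmonicExtension G B hG hB f.ofLp) x
  map_add' f g := by ext x; simp [add_comm]
  map_smul' c f := by ext x; simp

theorem dirichletToNeumann_isSymmetric (G : SimpleGraph V) [DecidableRel G.Adj] (B : Finset V)
    (hG : G.Connected) (hB : B.Nonempty) : (dirichletToNeumann G B hG hB).IsSymmetric := by
  have key : ∀ f g : B → ℝ, ∑ x : B, laplacian G (harmonicExtension G B hG hB f) x * g x =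
      ∑ x, laplacian G (harmonicExtension G B hG hB f) x * harmonicExtension G B hG hB g x := by
    intro f g
    obtain ⟨hf, -⟩ := (eq_harmonicExtension_iff G B hG hB f _).1 rfl
    obtain ⟨-, hg⟩ := (eq_harmonicExtension_iff G B hG hB g _).1 rfl
    rw [← Finset.sum_subset (Finset.subset_univ B)
      (fun x _ hx => by rw [hf x hx, zero_mul]), ← Finset.sum_coe_sort B]
    exact Finset.sum_congr rfl fun x _ => by rw [hg x]
  intro f g
  have h := key f.ofLp g.ofLp
  rw [sum_laplacian_mul_comm] at h
  have h' := key g.ofLp f.ofLp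
  simp only [PiLp.inner_apply, dirichletToNeumann, LinearMap.coe_mk, AddHom.coe_mk,
    RCLike.inner_apply, conj_trivial, mul_neg, neg_mul, Finset.sum_neg_distrib, neg_inj]
  rw [h', Finset.sum_congr rfl fun x _ => mul_comm (g.ofLp x) _, h]
  exact Finset.sum_congr rfl fun x _ => mul_comm _ _

/-- The Steklov eigenvalues, that is, the eigenvalues of the Dirichlet-to-Neumann map, counted
with multiplicity and in increasing order. The index starts at `0`, so that the entry at `i`
is `σ_{i+1}`. (Mathlib lists the eigenvalues of a symmetric operator in decreasing order.) -/
noncomputable def steklovEigenvalue (G : SimpleGraph V) [DecidableRel G.Adj] (B : Finset V)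
    (hG : G.Connected) (i : Fin B.card) : ℝ :=
  (dirichletToNeumann_isSymmetric G B hG (Finset.card_pos.1 i.pos)).eigenvalues
    (show Module.finrank ℝ (EuclideanSpace ℝ B) = B.card by simp) i.rev

end Steklov

/-! By min-max, it suffices to bound the Dirichlet energy of the harmonic extension `u` from below
when `f` has mean zero on `B`. Subtracting the mean over `V` keeps the energy and, as `u` has mean
zero on `B`, does not bring the full sum of squares below the sum over `B`. Fiedler's inequality on
the whole graph (`edgeConnectivity_mul_sum_sq_le`) then applies.

For Fiedler's inequality, list the values of `u` increasingly. An edge contributes at least the sum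
of the squared consecutive increments it spans, and each increment is spanned by at least `e(G)`
edges, so the energy is at least `e(G)` times that of a path on `|V|` vertices. The path's spectral
gap gives the cosine. The second bound is Whitney's inequality. -/

namespace Steklov

/-! ### Spectral gap of the path. -/

/-- Discrete Dirichlet (Wirtinger) inequality for a sequence vanishing at `0` and `m + 1`. -/
theorem sum_sq_le_sum_diff_sq_of_dirichlet (m : ℕ) (S : ℕ → ℝ) (h0 : S 0 = 0)
    (h1 : S (m + 1) = 0) :
    2 * (1 - Real.cos (Real.pi / ((m + 1 : ℕ) : ℝ))) * ∑ i ∈ Finset.range m, S (i + 1) ^ 2 ≤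
      ∑ i ∈ Finset.range (m + 1), (S (i + 1) - S i) ^ 2 := by
  set θ : ℝ := Real.pi / ((m + 1 : ℕ) : ℝ) with hθ
  -- The positive ground state of the Dirichlet path, with eigenvalue `2 * (1 - cos θ)`.
  set φ : ℕ → ℝ := fun k => Real.sin (k * θ) with hφ
  have hm : (0 : ℝ) < ((m + 1 : ℕ) : ℝ) := by positivity
  have hpos : ∀ k, 1 ≤ k → k ≤ m → 0 < φ k := by
    intro k hk hkm
    have hk' : (1 : ℝ) ≤ k := by exact_mod_cast hk
    have hkm' : (k : ℝ) < ((m + 1 : ℕ) : ℝ) := by exact_mod_cast Nat.lt_succ_of_le hkm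
    apply Real.sin_pos_of_pos_of_lt_pi
    · have := Real.pi_pos
      positivity
    · rw [hθ, mul_div_assoc', div_lt_iff₀ hm, mul_comm]
      exact mul_lt_mul_of_pos_left hkm' Real.pi_pos
  have hrec : ∀ k, φ k + φ (k + 2) = 2 * Real.cos θ * φ (k + 1) := by
    intro k
    simp only [hφ]
    have e1 : (k : ℝ) * θ = ((k + 1 : ℕ) : ℝ) * θ - θ := by push_cast; ring
    have e2 : ((k + 2 : ℕ) : ℝ) * θ = ((k + 1 : ℕ) : ℝ) * θ + θ := by push_cast; ring
    rw [e1, e2, Real.sin_sub, Real.sin_add]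
    ring
  have hend : φ (m + 1) = 0 := by
    simp only [hφ, hθ]
    rw [mul_div_cancel₀ _ hm.ne', Real.sin_pi]
  -- Summation of Picone's identity: each induction step discards a square that vanishes when `S` is
  -- proportional to `φ`.
  have claim : ∀ k, k + 1 ≤ m →
      2 * (1 - Real.cos θ) * ∑ i ∈ Finset.range k, S (i + 1) ^ 2 +
        (1 - φ k / φ (k + 1)) * S (k + 1) ^ 2 ≤
      ∑ i ∈ Finset.range (k + 1), (S (i + 1) - S i) ^ 2 := by
    intro k
    induction k with
    | zero => intro _; simp [h0, hφ]
    | succ k ih =>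
      intro hk
      have ih := ih (by omega)
      rw [Finset.sum_range_succ (fun i => (S (i + 1) - S i) ^ 2) (k + 1),
        Finset.sum_range_succ (fun i => S (i + 1) ^ 2) k]
      have p1 := hpos (k + 1) (by omega) (by omega)
      have p2 := hpos (k + 2) (by omega) (by omega)
      have hr := hrec k
      have e : φ k / φ (k + 1) = 2 * Real.cos θ - φ (k + 2) / φ (k + 1) := by
        field_simp
        linarith
      rw [e] at ih
      have key : 0 ≤ φ (k + 2) / φ (k + 1) * S (k + 1) ^ 2 - 2 * (S (k + 1) * S (k + 2)) +
          φ (k + 1) / φ (k + 2) * S (k + 2) ^ 2 := by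
        have : φ (k + 2) / φ (k + 1) * S (k + 1) ^ 2 - 2 * (S (k + 1) * S (k + 2)) +
          φ (k + 1) / φ (k + 2) * S (k + 2) ^ 2 =
          (φ (k + 2) * S (k + 1) - φ (k + 1) * S (k + 2)) ^ 2 / (φ (k + 1) * φ (k + 2)) := by
          field_simp
          ring
        rw [this]
        positivity
      simp only [add_assoc, Nat.reduceAdd] at *
      linarith
  rcases m with _ | m
  · simp [h0, h1]
  · have hc := claim m le_rfl
    rw [Finset.sum_range_succ _ (m + 1), Finset.sum_range_succ _ m, h1]
    have p1 := hpos (m + 1) (by omega) (by omega)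
    have e : φ m / φ (m + 1) = 2 * Real.cos θ := by
      have hr := hrec m
      rw [hend] at hr
      field_simp
      linarith
    rw [e] at hc
    linarith

/-- The spectral gap of the path: a discrete Poincaré inequality. -/
theorem sum_sq_le_sum_diff_sq_of_sum_eq_zero (m : ℕ) (a : ℕ → ℝ)
    (ha : ∑ i ∈ Finset.range (m + 1), a i = 0) :
    2 * (1 - Real.cos (Real.pi / ((m + 1 : ℕ) : ℝ))) * ∑ i ∈ Finset.range (m + 1), a i ^ 2 ≤
      ∑ i ∈ Finset.range m, (a (i + 1) - a i) ^ 2 := by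
  set S : ℕ → ℝ := fun k => ∑ i ∈ Finset.range k, a i with hS
  have hd := sum_sq_le_sum_diff_sq_of_dirichlet m S (by simp [hS]) ha
  have hSd : ∀ i, S (i + 1) - S i = a i := fun i => by simp [hS, Finset.sum_range_succ]
  simp only [hSd] at hd
  have hpos : 0 < 2 * (1 - Real.cos (Real.pi / ((m + 1 : ℕ) : ℝ))) := by
    have hm : (1 : ℝ) ≤ ((m + 1 : ℕ) : ℝ) := by exact_mod_cast Nat.le_add_left 1 m
    have h := Real.cos_lt_cos_of_nonneg_of_le_pi le_rfl
      (div_le_self Real.pi_pos.le hm) (div_pos Real.pi_pos (by linarith))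
    rw [Real.cos_zero] at h
    linarith
  set l := 2 * (1 - Real.cos (Real.pi / ((m + 1 : ℕ) : ℝ)))
  have habel : ∀ m, ∑ i ∈ Finset.range (m + 1), a i ^ 2 =
      a m * S (m + 1) - ∑ i ∈ Finset.range m, S (i + 1) * (a (i + 1) - a i) := by
    intro m
    induction m with
    | zero => simp [hS, sq]
    | succ m ih =>
      rw [Finset.sum_range_succ, ih, Finset.sum_range_succ _ m]
      have := hSd (m + 1)
      linear_combination (a (m + 1)) * (-this)
  have hA := habel m
  rw [show S (m + 1) = 0 from ha, mul_zero, zero_sub, ← Finset.sum_neg_distrib] at hA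
  -- Duality between mean-zero sequences and their partial sums: Young's inequality with weight `l`.
  -- By `hd`, the first term on the right is at most `l * ∑ a i ^ 2`, half of the left side.
  have hle : 2 * l * ∑ i ∈ Finset.range (m + 1), a i ^ 2 ≤
      l * (l * ∑ i ∈ Finset.range m, S (i + 1) ^ 2) +
        ∑ i ∈ Finset.range m, (a (i + 1) - a i) ^ 2 := by
    rw [hA, Finset.mul_sum, Finset.mul_sum, Finset.mul_sum, ← Finset.sum_add_distrib]
    refine Finset.sum_le_sum fun i _ => ?_
    linarith [sq_nonneg (l * S (i + 1) + (a (i + 1) - a i))]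
  have := mul_le_mul_of_nonneg_left hd hpos.le
  linarith

end Steklov

/-! ### Cuts and Whitney's inequality. -/

namespace Steklov

variable {V : Type*} 

/-- A vertex set whose edges to the complement are all deleted cannot be left by a walk. -/
theorem not_preconnected_of_forall_mem {H : SimpleGraph V} {X : Set V} {a b : V} (ha : a ∈ X)
    (hb : b ∉ X) (h : ∀ x ∈ X, ∀ y, H.Adj x y → y ∈ X) : ¬ H.Preconnected := by
  intro hH
  obtain ⟨p⟩ := hH a b
  have : ∀ {u v : V}, H.Walk u v → u ∈ X → v ∈ X := by
    intro u v p
    induction p with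
    | nil => exact id
    | cons hadj _ ih => exact fun hu => ih (h _ hu _ hadj)
  exact hb (this p ha)

variable [Fintype V] [DecidableEq V]

/-- The ordered pairs `(x, y)` with `x ∈ X`, `y ∉ X`, `x ∼ y`. -/
def cutPairs (G : SimpleGraph V) [DecidableRel G.Adj] (X : Finset V) : Finset (V × V) :=
  Finset.univ.filter fun p => p.1 ∈ X ∧ p.2 ∉ X ∧ G.Adj p.1 p.2

/-- Only one end of a cut edge lies in `X`, so forgetting the orientation loses nothing. -/
theorem card_image_cutPairs (G : SimpleGraph V) [DecidableRel G.Adj] (X : Finset V) :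
    ((cutPairs G X).image fun p => s(p.1, p.2)).card = (cutPairs G X).card := by
  refine Finset.card_image_of_injOn ?_
  rintro ⟨x, y⟩ hp ⟨x', y'⟩ hp' h
  simp only [cutPairs, Finset.coe_filter, Finset.mem_univ, true_and, Set.mem_ofPred_eq] at hp hp'
  rcases Sym2.eq_iff.1 h with ⟨rfl, rfl⟩ | ⟨rfl, rfl⟩
  · rfl
  · exact absurd hp.1 hp'.2.1

theorem edgeConnectivity_le_card_cutPairs (G : SimpleGraph V) [DecidableRel G.Adj] (X : Finset V)
    {a b : V} (ha : a ∈ X) (hb : b ∉ X) : edgeConnectivity G ≤ (cutPairs G X).card := by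
  refine Nat.sInf_le ⟨(cutPairs G X).image fun p => s(p.1, p.2), ?_, ?_, card_image_cutPairs G X⟩
  · intro e he
    obtain ⟨⟨x, y⟩, hp, rfl⟩ := Finset.mem_image.1 (Finset.mem_coe.1 he)
    simp only [cutPairs, Finset.mem_filter] at hp
    exact hp.2.2.2
  · refine not_preconnected_of_forall_mem (X := X) ha hb fun x hx y hxy => ?_
    rw [SimpleGraph.deleteEdges_adj] at hxy
    by_contra hy
    refine hxy.2 (Finset.mem_coe.2 (Finset.mem_image.2 ⟨(x, y), ?_, rfl⟩))
    simpa [cutPairs] using ⟨hx, hy, hxy.1⟩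

/-- The edge connectivity is attained by the cut of a proper vertex set. -/
theorem exists_card_cutPairs_le_edgeConnectivity (G : SimpleGraph V) [DecidableRel G.Adj]
    {p q : V} (hpq : p ≠ q) : ∃ (X : Finset V) (a b : V), a ∈ X ∧ b ∉ X ∧
      (cutPairs G X).card ≤ edgeConnectivity G := by
  classical
  have hne : {k | ∃ S : Finset (Sym2 V), (S : Set (Sym2 V)) ⊆ G.edgeSet ∧
      ¬ (G.deleteEdges (S : Set (Sym2 V))).Preconnected ∧ S.card = k}.Nonempty := by
    refine ⟨_, G.edgeFinset, by simp, ?_, rfl⟩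
    refine not_preconnected_of_forall_mem (X := {p}) (a := p) (b := q) rfl
      (fun h => hpq h.symm) fun x _ y hxy => ?_
    rw [SimpleGraph.deleteEdges_adj] at hxy
    exact absurd (by simpa using hxy.1) hxy.2
  obtain ⟨S, -, hS, hcard⟩ := Nat.sInf_mem hne
  obtain ⟨a, b, hab⟩ : ∃ a b, ¬ (G.deleteEdges (S : Set (Sym2 V))).Reachable a b := by
    by_contra! h
    exact hS fun a b => h a b
  refine ⟨Finset.univ.filter fun x => (G.deleteEdges (S : Set (Sym2 V))).Reachable a x, a, b,
    by simp, by simpa using hab, ?_⟩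
  rw [edgeConnectivity, ← hcard, ← card_image_cutPairs]
  refine Finset.card_le_card fun e he => ?_
  obtain ⟨⟨x, y⟩, hp, rfl⟩ := Finset.mem_image.1 he
  simp only [cutPairs, Finset.mem_filter, Finset.mem_univ, true_and] at hp
  by_contra hxy
  exact hp.2.1 (hp.1.trans (SimpleGraph.Adj.reachable
    (SimpleGraph.deleteEdges_adj.2 ⟨hp.2.2, fun h => hxy (Finset.mem_coe.1 h)⟩)))

omit [Fintype V] in
theorem vertexConnectivity_le_card (G : SimpleGraph V) (S X : Finset V) {a b : V} (haS : a ∉ S)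
    (hbS : b ∉ S) (ha : a ∈ X) (hb : b ∉ X)
    (h : ∀ x ∈ X, ∀ y ∉ X, G.Adj x y → x ∈ S ∨ y ∈ S) : vertexConnectivity G ≤ S.card := by
  refine Nat.sInf_le ⟨S, ?_, rfl⟩
  refine not_preconnected_of_forall_mem (X := {x | (x : V) ∈ X}) (a := ⟨a, haS⟩) (b := ⟨b, hbS⟩)
    ha hb fun x hx y hxy => ?_
  by_contra hy
  rcases h x hx y hy hxy with h | h
  exacts [x.2 h, y.2 h]

/-- Whitney's inequality for a graph that is not complete. -/
theorem vertexConnectivity_le_edgeConnectivity (G : SimpleGraph V) [DecidableRel G.Adj]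
    {p q : V} (hpq : p ≠ q) (hadj : ¬ G.Adj p q) :
    vertexConnectivity G ≤ edgeConnectivity G := by
  obtain ⟨X, a, b, ha, hb, hX⟩ := exists_card_cutPairs_le_edgeConnectivity G hpq
  refine le_trans ?_ hX
  by_cases hex : ∃ a ∈ X, ∃ b ∉ X, ¬ G.Adj a b
  -- From each cut edge delete one end: the outer one if the edge starts at `a`, else the inner one.
  -- Since `a` and `b` are not adjacent, both survive.
  · obtain ⟨a, ha, b, hb, hab⟩ := hex
    refine le_trans (vertexConnectivity_le_card G
      ((cutPairs G X).image fun e => if e.1 = a then e.2 else e.1) X ?_ ?_ ha hb ?_)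
      Finset.card_image_le
    · intro h
      obtain ⟨⟨x, y⟩, he, h⟩ := Finset.mem_image.1 h
      simp only [cutPairs, Finset.mem_filter, Finset.mem_univ, true_and] at he
      split_ifs at h with hx
      · exact he.2.1 (show y ∈ X from (show y = a from h) ▸ ha)
      · exact hx h
    · intro h
      obtain ⟨⟨x, y⟩, he, h⟩ := Finset.mem_image.1 h
      simp only [cutPairs, Finset.mem_filter, Finset.mem_univ, true_and] at he
      split_ifs at h with hx
      · exact hab (hx ▸ h ▸ he.2.2)
      · exact hb (h ▸ he.1)
    · intro x hx y hy hxy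
      have hm : (if x = a then y else x) ∈
          (cutPairs G X).image fun e => if e.1 = a then e.2 else e.1 :=
        Finset.mem_image.2 ⟨(x, y), by simpa [cutPairs] using ⟨hx, hy, hxy⟩, rfl⟩
      split_ifs at hm
      exacts [Or.inr hm, Or.inl hm]
  -- Every pair across the cut is now an edge, so the cut has `|X| * |Xᶜ| ≥ |V| - 1` edges, while
  -- deleting all vertices but `p` and `q` costs `|V| - 2`.
  · push Not at hex
    have hcut : cutPairs G X = X ×ˢ Xᶜ := by
      ext ⟨x, y⟩
      simp only [cutPairs, Finset.mem_filter, Finset.mem_univ, true_and, Finset.mem_product,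
        Finset.mem_compl]
      exact ⟨fun h => ⟨h.1, h.2.1⟩, fun h => ⟨h.1, h.2, hex x h.1 y h.2⟩⟩
    have h1 : 1 ≤ X.card := Finset.card_pos.2 ⟨a, ha⟩
    have h2 : 1 ≤ Xᶜ.card := Finset.card_pos.2 ⟨b, Finset.mem_compl.2 hb⟩
    have hsum : X.card + Xᶜ.card = Fintype.card V := Finset.card_add_card_compl X
    have hv : vertexConnectivity G ≤ ({p, q}ᶜ : Finset V).card := by
      refine vertexConnectivity_le_card G _ {p} (a := p) (b := q) (by simp) (by simp) (by simp)
        (by simpa using hpq.symm) fun x hx y hy hxy => Or.inr ?_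
      rw [Finset.mem_singleton] at hx hy
      subst hx
      have : y ≠ q := by rintro rfl; exact hadj hxy
      simp [hy, this]
    rw [Finset.card_compl, Finset.card_pair hpq] at hv
    rw [hcut, Finset.card_product]
    obtain ⟨s, hs⟩ := Nat.exists_eq_add_of_le h1
    obtain ⟨t, ht⟩ := Nat.exists_eq_add_of_le h2
    rw [hs, ht] at hsum ⊢
    have : (1 + s) * (1 + t) = 1 + s + t + s * t := by ring
    omega

end Steklov

/-! ### Fiedler's inequality by sorting the values. -/

namespace Steklov

/-- Squaring is superadditive on nonnegative increments; the order statement rides along in the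
induction to sign the cross term. -/
theorem sum_Ico_sq_sub_le_sq_sub {a : ℕ → ℝ} {m i j : ℕ} (ha : ∀ k < m, a k ≤ a (k + 1))
    (hij : i ≤ j) (hj : j ≤ m) :
    a i ≤ a j ∧ ∑ k ∈ Finset.Ico i j, (a (k + 1) - a k) ^ 2 ≤ (a j - a i) ^ 2 := by
  induction j, hij using Nat.le_induction with
  | base => simp
  | succ j hij ih =>
    obtain ⟨h1, h2⟩ := ih (by omega)
    have h3 := ha j (by omega)
    rw [Finset.sum_Ico_succ_top hij]
    exact ⟨h1.trans h3, by nlinarith [mul_nonneg (sub_nonneg.2 h1) (sub_nonneg.2 h3)]⟩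

theorem exists_equiv_monotone {V : Type*} [Fintype V] {n : ℕ} (hn : Fintype.card V = n)
    (u : V → ℝ) : ∃ σ : Fin n ≃ V, Monotone (u ∘ σ) := by
  let τ := (Fintype.equivFinOfCardEq hn).symm
  exact ⟨(Tuple.sort (u ∘ τ)).trans τ, Tuple.monotone_sort (u ∘ τ)⟩

variable {V : Type*} [Fintype V] [DecidableEq V]

/-- Dirichlet's energy as a sum over the edges, oriented along an injective labelling. -/
theorem neg_sum_laplacian_mul_self (G : SimpleGraph V) [DecidableRel G.Adj] (u : V → ℝ)
    {r : V → ℕ} (hr : Function.Injective r) :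
    -∑ x, laplacian G u x * u x =
      ∑ x, ∑ y, if G.Adj x y ∧ r x < r y then (u y - u x) ^ 2 else 0 := by
  have h := G.lapMatrix_toLinearMap₂' ℝ u
  have e : ∑ x, ∑ y, (if G.Adj x y then (u x - u y) ^ 2 else 0) =
      ∑ x, ∑ y, (if G.Adj x y ∧ r x < r y then (u y - u x) ^ 2 else 0) +
      ∑ y, ∑ x, (if G.Adj x y ∧ r x < r y then (u y - u x) ^ 2 else 0) := by
    rw [← Finset.sum_add_distrib]
    refine Finset.sum_congr rfl fun x _ => ?_
    rw [← Finset.sum_add_distrib]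
    refine Finset.sum_congr rfl fun y _ => ?_
    by_cases hxy : G.Adj x y
    · rcases lt_or_gt_of_ne (hr.ne hxy.ne) with hlt | hlt
      · simp [hxy, hxy.symm, hlt, hlt.not_gt, sub_sq_comm]
      · simp [hxy, hxy.symm, hlt, hlt.not_gt]
    · have hyx : ¬ G.Adj y x := fun h => hxy h.symm
      simp [hxy, hyx]
  rw [e, Finset.sum_comm (f := fun y x => if G.Adj x y ∧ r x < r y then (u y - u x) ^ 2 else 0),
    add_self_div_two, Matrix.toLinearMap₂'_apply', dotProduct] at h
  rw [← h, ← Finset.sum_neg_distrib]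
  exact Finset.sum_congr rfl fun x _ => by simp [laplacian, mul_comm]

/-- Fiedler's lower bound for the algebraic connectivity, as a Poincaré inequality. -/
theorem edgeConnectivity_mul_sum_sq_le (G : SimpleGraph V) [DecidableRel G.Adj] [Nonempty V]
    (u : V → ℝ) (hu : ∑ x, u x = 0) :
    2 * (edgeConnectivity G : ℝ) * (1 - Real.cos (Real.pi / (Fintype.card V : ℝ))) *
      ∑ x, u x ^ 2 ≤ -∑ x, laplacian G u x * u x := by
  obtain ⟨m, hm⟩ : ∃ m, Fintype.card V = m + 1 :=
    Nat.exists_eq_succ_of_ne_zero Fintype.card_ne_zero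
  obtain ⟨σ, hσ⟩ := exists_equiv_monotone hm u
  -- `Fin.ofNat` wraps modulo `m + 1`; only indices up to `m` are used.
  set a : ℕ → ℝ := fun i => u (σ (Fin.ofNat (m + 1) i)) with hadef
  set r : V → ℕ := fun x => (σ.symm x : ℕ) with hrdef
  have har : ∀ x, a (r x) = u x := fun x => by simp [hadef, hrdef]
  have hrm : ∀ x, r x ≤ m := fun x => Nat.lt_succ_iff.1 (σ.symm x).2
  have hr : Function.Injective r := Fin.val_injective.comp σ.symm.injective
  have hsum : ∀ g : ℝ → ℝ, ∑ i ∈ Finset.range (m + 1), g (a i) = ∑ x, g (u x) := by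
    intro g
    rw [Finset.sum_range, ← σ.sum_comp]
    exact Finset.sum_congr rfl fun i _ => by simp [hadef]
  have hamono : ∀ k < m, a k ≤ a (k + 1) := by
    intro k hk
    refine hσ (Fin.le_def.2 ?_)
    simp only [Fin.val_ofNat]
    rw [Nat.mod_eq_of_lt (by omega), Nat.mod_eq_of_lt (by omega)]
    omega
  have hpath := sum_sq_le_sum_diff_sq_of_sum_eq_zero m a ((hsum id).trans hu)
  rw [hsum (fun t => t ^ 2), ← hm] at hpath
  -- The first `k + 1` vertices in the sorted order form a proper nonempty set because `k < m`, so
  -- its cut disconnects.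
  have hcut : ∀ k < m, (edgeConnectivity G : ℝ) ≤
      ∑ x, ∑ y, if G.Adj x y ∧ r x ≤ k ∧ k < r y then (1 : ℝ) else 0 := by
    intro k hk
    have h := edgeConnectivity_le_card_cutPairs G (Finset.univ.filter fun x => r x ≤ k)
      (a := σ 0) (b := σ (Fin.last m)) (by simp [hrdef]) (by simpa [hrdef] using hk)
    rw [← Fintype.sum_prod_type' (f := fun x y => if G.Adj x y ∧ r x ≤ k ∧ k < r y
      then (1 : ℝ) else 0), Finset.sum_boole]
    refine (Nat.cast_le.2 h).trans (Nat.cast_le.2 (Finset.card_le_card fun p hp => ?_))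
    simp only [cutPairs, Finset.mem_filter, Finset.mem_univ, true_and, not_le] at hp ⊢
    exact ⟨hp.2.2, hp.1, hp.2.1⟩
  have henergy : (edgeConnectivity G : ℝ) * ∑ k ∈ Finset.range m, (a (k + 1) - a k) ^ 2 ≤
      -∑ x, laplacian G u x * u x := by
    calc _ ≤ ∑ k ∈ Finset.range m, (∑ x, ∑ y, if G.Adj x y ∧ r x ≤ k ∧ k < r y
            then (1 : ℝ) else 0) * (a (k + 1) - a k) ^ 2 := by
          rw [Finset.mul_sum]
          exact Finset.sum_le_sum fun k hk =>
            mul_le_mul_of_nonneg_right (hcut k (Finset.mem_range.1 hk)) (sq_nonneg _)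
      _ = ∑ x, ∑ y, ∑ k ∈ Finset.range m, if G.Adj x y ∧ r x ≤ k ∧ k < r y
            then (a (k + 1) - a k) ^ 2 else 0 := by
          simp only [Finset.sum_mul, ite_mul, one_mul, zero_mul]
          rw [Finset.sum_comm]
          exact Finset.sum_congr rfl fun x _ => Finset.sum_comm
      _ ≤ _ := by
          rw [neg_sum_laplacian_mul_self G u hr]
          refine Finset.sum_le_sum fun x _ => Finset.sum_le_sum fun y _ => ?_
          rw [← Finset.sum_filter]
          split_ifs with h
          · rw [← har x, ← har y]
            refine le_trans (Finset.sum_le_sum_of_subset_of_nonneg (fun k hk => ?_)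
              fun _ _ _ => sq_nonneg _) (sum_Ico_sq_sub_le_sq_sub hamono h.2.le (hrm y)).2
            exact Finset.mem_Ico.2 (Finset.mem_filter.1 hk).2.2
          · rw [Finset.filter_eq_empty_iff.2 fun k _ hk => h ⟨hk.1, hk.2.1.trans_lt hk.2.2⟩,
              Finset.sum_empty]
  have := mul_le_mul_of_nonneg_left hpath (Nat.cast_nonneg (α := ℝ) (edgeConnectivity G))
  linarith

end Steklov

/-! ### Min-max and the transfer to the Steklov problem. -/

open scoped InnerProductSpace in
/-- One half of the min-max principle: a lower bound of the quadratic form on a hyperplane bounds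
all eigenvalues but the least. -/
theorem LinearMap.IsSymmetric.le_eigenvalues_of_forall_inner_eq_zero {E : Type*}
    [NormedAddCommGroup E] [InnerProductSpace ℝ E] [FiniteDimensional ℝ E] {T : E →ₗ[ℝ] E}
    (hT : T.IsSymmetric) {n : ℕ} (hn : Module.finrank ℝ E = n) {i j : Fin n} (hij : i < j)
    (w : E) {c : ℝ} (h : ∀ f : E, ⟪w, f⟫_ℝ = 0 → c * ‖f‖ ^ 2 ≤ ⟪T f, f⟫_ℝ) :
    c ≤ hT.eigenvalues hn i := by
  set b := hT.eigenvectorBasis hn with hb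
  -- The plane of two eigenvectors meets the hyperplane orthogonal to `w` in a nonzero vector, whose
  -- Rayleigh quotient is at most the larger eigenvalue, the one at `i`.
  obtain ⟨α, β, hpos, h0⟩ : ∃ α β : ℝ, 0 < α ^ 2 + β ^ 2 ∧
      α * ⟪w, b i⟫_ℝ + β * ⟪w, b j⟫_ℝ = 0 := by
    by_cases hi : ⟪w, b i⟫_ℝ = 0
    · exact ⟨1, 0, by norm_num, by simp [hi]⟩
    · exact ⟨⟪w, b j⟫_ℝ, -⟪w, b i⟫_ℝ,
        add_pos_of_nonneg_of_pos (sq_nonneg _) (sq_pos_iff.2 (neg_ne_zero.2 hi)), by ring⟩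
  have hii : ⟪b i, b i⟫_ℝ = 1 := by simp
  have hjj : ⟪b j, b j⟫_ℝ = 1 := by simp
  have hi : ⟪b i, b j⟫_ℝ = 0 := b.orthonormal.2 hij.ne
  have hj : ⟪b j, b i⟫_ℝ = 0 := b.orthonormal.2 hij.ne'
  have hle : hT.eigenvalues hn j ≤ hT.eigenvalues hn i := hT.eigenvalues_antitone hn hij.le
  have hf := h (α • b i + β • b j) (by simpa [inner_add_right, inner_smul_right] using h0)
  have hTi : T (b i) = hT.eigenvalues hn i • b i := hT.apply_eigenvectorBasis hn i
  have hTj : T (b j) = hT.eigenvalues hn j • b j := hT.apply_eigenvectorBasis hn j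
  rw [← real_inner_self_eq_norm_sq] at hf
  simp only [map_add, map_smul, hTi, hTj, inner_add_left, inner_add_right, real_inner_smul_left,
    real_inner_smul_right, hii, hjj, hi, hj] at hf
  have := mul_le_mul_of_nonneg_right hle (sq_nonneg β)
  refine le_of_mul_le_mul_right ?_ hpos
  linarith

namespace Steklov

variable {V : Type*} [Fintype V] [DecidableEq V]

-- Green's formula: harmonicity off `B` reduces the sum over `V` to one over `B`.
open scoped InnerProductSpace in
theorem inner_dirichletToNeumann_self (G : SimpleGraph V) [DecidableRel G.Adj] (B : Finset V)
    (hG : G.Connected) (hB : B.Nonempty) (f : EuclideanSpace ℝ B) :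
    ⟪dirichletToNeumann G B hG hB f, f⟫_ℝ =
      -∑ x, laplacian G (harmonicExtension G B hG hB f.ofLp) x *
      harmonicExtension G B hG hB f.ofLp x := by
  obtain ⟨h1, h2⟩ := (eq_harmonicExtension_iff G B hG hB f.ofLp _).1 rfl
  rw [← Finset.sum_subset (Finset.subset_univ B)
    (fun x _ hx => by rw [h1 x hx, zero_mul]), ← Finset.sum_coe_sort B, ← Finset.sum_neg_distrib]
  simp only [PiLp.inner_apply, dirichletToNeumann, LinearMap.coe_mk, AddHom.coe_mk,
    RCLike.inner_apply, conj_trivial]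
  exact Finset.sum_congr rfl fun x _ => by rw [h2 x]; ring

/-- The Poincaré inequality for functions of mean zero on a subset `B`, measured on `B`. -/
theorem edgeConnectivity_mul_sum_sq_le_of_sum_eq_zero (G : SimpleGraph V) [DecidableRel G.Adj]
    (B : Finset V) (hB : B.Nonempty) (u : V → ℝ) (hu : ∑ x ∈ B, u x = 0) :
    2 * (edgeConnectivity G : ℝ) * (1 - Real.cos (Real.pi / (Fintype.card V : ℝ))) *
      ∑ x ∈ B, u x ^ 2 ≤ -∑ x, laplacian G u x * u x := by
  have : Nonempty V := ⟨hB.choose⟩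
  have hc : (Fintype.card V : ℝ) ≠ 0 := Nat.cast_ne_zero.2 Fintype.card_ne_zero
  set t : ℝ := (∑ x, u x) / Fintype.card V with ht
  set v : V → ℝ := fun x => u x - t with hv
  have hv0 : ∑ x, v x = 0 := by
    simp only [hv, Finset.sum_sub_distrib, Finset.sum_const, Finset.card_univ, nsmul_eq_mul, ht]
    field_simp
    ring
  have hlap : laplacian G v = laplacian G u := by
    ext x
    simp [laplacian_apply, hv]
  have hzero : ∑ x, laplacian G u x = 0 := by
    have h := sum_laplacian_mul_comm G u fun _ => 1
    have h1 : laplacian G (fun _ : V => (1 : ℝ)) = 0 := by ext x; simp [laplacian_apply]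
    simpa [h1] using h
  have henergy : ∑ x, laplacian G v x * v x = ∑ x, laplacian G u x * u x := by
    rw [hlap]
    simp only [hv, mul_sub, Finset.sum_sub_distrib, ← Finset.sum_mul, hzero, zero_mul, sub_zero]
  -- Shifting by `t` only adds `t ^ 2` per vertex of `B`, as the cross term vanishes by `hu`.
  have hnorm : ∑ x ∈ B, u x ^ 2 ≤ ∑ x, v x ^ 2 :=
    calc ∑ x ∈ B, u x ^ 2 ≤ ∑ x ∈ B, u x ^ 2 - 2 * t * ∑ x ∈ B, u x + ∑ _x ∈ B, t ^ 2 := by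
          rw [hu, mul_zero, sub_zero]
          exact le_add_of_nonneg_right (Finset.sum_nonneg fun _ _ => sq_nonneg t)
      _ = ∑ x ∈ B, v x ^ 2 := by
          rw [Finset.mul_sum, ← Finset.sum_sub_distrib, ← Finset.sum_add_distrib]
          exact Finset.sum_congr rfl fun x _ => by simp only [hv]; ring
      _ ≤ ∑ x, v x ^ 2 :=
          Finset.sum_le_sum_of_subset_of_nonneg (Finset.subset_univ B) fun _ _ _ => sq_nonneg _
  rw [← henergy]
  refine le_trans (mul_le_mul_of_nonneg_left hnorm ?_) (edgeConnectivity_mul_sum_sq_le G v hv0)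
  exact mul_nonneg (by positivity) (sub_nonneg.2 (Real.cos_le_one _))

end Steklov

theorem mainTheorem6 {V : Type*} [Fintype V] [DecidableEq V]
    (G : SimpleGraph V) [DecidableRel G.Adj] (B : Finset V)
    (hG : G.Connected) (hGB : Steklov.IsBoundary G B) (hB : 2 ≤ B.card) :
    Steklov.steklovEigenvalue G B hG ⟨1, hB⟩ ≥
        2 * (Steklov.edgeConnectivity G : ℝ) * (1 - Real.cos (Real.pi / (Fintype.card V : ℝ))) ∧
      2 * (Steklov.edgeConnectivity G : ℝ) * (1 - Real.cos (Real.pi / (Fintype.card V : ℝ))) ≥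
        2 * (Steklov.vertexConnectivity G : ℝ) *
          (1 - Real.cos (Real.pi / (Fintype.card V : ℝ))) := by
  have hne : B.Nonempty := Finset.card_pos.1 (by omega)
  constructor
  -- In the decreasing order `σ_2` precedes the last entry `Fin.rev 0`, which is `σ_1`.
  -- Orthogonality to the constant function means mean zero on `B`.
  · refine LinearMap.IsSymmetric.le_eigenvalues_of_forall_inner_eq_zero
      (Steklov.dirichletToNeumann_isSymmetric G B hG hne) (by simp)
      (j := Fin.rev ⟨0, by omega⟩) (by simp [Fin.lt_def]; omega) (WithLp.toLp 2 fun _ => 1)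
      fun f hf => ?_
    obtain ⟨-, h2⟩ := (Steklov.eq_harmonicExtension_iff G B hG hne f.ofLp _).1 rfl
    have hsum : ∀ g : ℝ → ℝ, ∑ x ∈ B, g (Steklov.harmonicExtension G B hG hne f.ofLp x) =
        ∑ x : B, g (f x) := fun g => by
      rw [← Finset.sum_coe_sort B]
      exact Finset.sum_congr rfl fun x _ => by rw [h2 x]
    have key := Steklov.edgeConnectivity_mul_sum_sq_le_of_sum_eq_zero G B hne
      (Steklov.harmonicExtension G B hG hne f.ofLp)
      ((hsum id).trans (by simpa [PiLp.inner_apply] using hf))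
    rw [hsum (fun t => t ^ 2)] at key
    rwa [Steklov.inner_dirichletToNeumann_self, EuclideanSpace.real_norm_sq_eq]
  -- Two boundary vertices supply the nonadjacent pair for Whitney's inequality.
  · obtain ⟨p, hp, q, hq, hpq⟩ := Finset.one_lt_card.1 hB
    have h := Steklov.vertexConnectivity_le_edgeConnectivity G hpq (hGB.not_adj p hp q hq)
    exact mul_le_mul_of_nonneg_right
      (mul_le_mul_of_nonneg_left (Nat.cast_le.2 h) zero_le_two)
      (sub_nonneg.2 (Real.cos_le_one _))
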